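/- Let $\mathbf F_r$ be a finite field with $r$ elements. For $j\ge 0$ put $$e_j(x)=\prod_{h\in\mathbf F_r[T],\ \deg h<j}(x-h),\qquad D_j=\prod_{h\in\mathbf F_r[T]\text{ monic},\ \deg h=j}h,\qquad E_{j,T,r}(x)=\frac{e_j(x)}{D_j}\in\mathbf F_r(T)[x],$$ where $h=0$ (of degree $-\infty$) is always included in the first product, so that $e_0(x)=x$. For an integer $i\ge 0$ with base-$r$ expansion $i=c_0+c_1r+\dots+c_kr^k$, $0\le c_j\le r-1$, let $$\mathcal E_{i,T,r}(x)=\prod_{j=0}^k E_{j,T,r}(x)^{c_j}.$$ Let $\pi$ be any irreducible polynomial in $\mathbf F_r[T]$, let $\mathcal O=\mathbf F_\pi[[\pi]]$ be the $\pi$-adic completion of $\mathbf F_r[T]$, let $K=\mathbf F_\pi((\pi))$ be its fraction field, with the absolute value $|x|=q^{-\operatorname{ord}_\pi(x)}$, where $q=\#\mathbf F_r[T]/(\pi)$, and let $C(\mathcal O,K)$ be the $K$-Banach space of continuous functions $\mathcal O\to K$ with the sup-norm $\|\cdot\|$. Then the functions $\mathcal E_{i,T,r}$, $i\ge 0$,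 form an orthonormal basis of $C(\mathcal O,K)$. That is, every $f\in C(\mathcal O,K)$ has a unique representation $$f=\sum_{i\ge 0}c_i\,\mathcal E_{i,T,r}\qquad(\text{convergence in sup-norm}),\qquad c_i\in K,\quad c_i\to 0,$$ and this representation satisfies $\|f\|=\max_{i\ge 0}|c_i|$. -/

import Mathlib

open Polynomial IsDedekindDomain Filter Topology
open scoped WithZero NNReal

noncomputable section

/-- A sequence `e` in a normed space `E` over a normed field `K` is an orthonormal basis (in the
sense of non-archimedean functional analysis) if every `x : E` has a unique expansion
`x = ∑ c n • e n` with coefficients tending to `0`, and for this expansion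
`‖x‖ = max ‖c n‖` (the maximum being attained). -/
def IsOrthonormalSchauderBasis (K : Type*) {E : Type*} [NormedField K] [NormedAddCommGroup E]
    [NormedSpace K E] (e : ℕ → E) : Prop :=
  ∀ x : E, ∃ c : ℕ → K,
    Tendsto c atTop (𝓝 0) ∧
    Tendsto (fun N => ∑ n ∈ Finset.range N, c n • e n) atTop (𝓝 x) ∧
    IsGreatest (Set.range fun n => ‖c n‖) ‖x‖ ∧
    ∀ c' : ℕ → K, Tendsto c' atTop (𝓝 0) →
      Tendsto (fun N => ∑ n ∈ Finset.range N, c' n • e n) atTop (𝓝 x) → c' = c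

/-- The extension of a sequence by digit expansions in base `r`: for
`i = c₀ + c₁ r + ⋯ + cₖ r ^ k` with `0 ≤ cⱼ < r`, the `i`-th term is
`e 0 ^ c₀ * e 1 ^ c₁ * ⋯ * e k ^ cₖ`. -/
def digitExtension {A : Type*} [CommMonoid A] (r : ℕ) (e : ℕ → A) (i : ℕ) : A :=
  ∏ j ∈ Finset.range (Nat.digits r i).length, e j ^ (Nat.digits r i).getD j 0

namespace Carlitz

section Polynomials

variable (F : Type*) [Field F] [Finite F]

theorem finite_degree_lt (j : ℕ) : {h : F[X] | h.degree < j}.Finite := by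
  have : Finite (degreeLT F j) := Finite.of_equiv _ (degreeLTEquiv F j).symm.toEquiv
  have h : {h : F[X] | h.degree < j} = (degreeLT F j : Set F[X]) := by
    ext h
    simp [mem_degreeLT]
  rw [h]
  exact Set.toFinite _

theorem finite_monic_natDegree (j : ℕ) : {h : F[X] | h.Monic ∧ h.natDegree = j}.Finite := by
  have : Finite (degreeLT F j) := Finite.of_equiv _ (degreeLTEquiv F j).symm.toEquiv
  have : Finite {h : F[X] // h.Monic ∧ h.natDegree = j} :=
    Finite.of_equiv _ (monicEquivDegreeLT (R := F) j).symm
  exact Set.finite_coe_iff.1 this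

/-- `e_j(x) = ∏ (x - h)` over all `h ∈ F[T]` of degree `< j`, a polynomial in `x` over `F[T]`.
The zero polynomial (of degree `-∞`) is always included, so `e_0(x) = x`. -/
def e (j : ℕ) : F[X][X] :=
  ∏ h ∈ (finite_degree_lt F j).toFinset, (X - C h)

/-- `D_j`, the product of all monic polynomials of degree `j` in `F[T]`. -/
def D (j : ℕ) : F[X] :=
  ∏ h ∈ (finite_monic_natDegree F j).toFinset, h

/-- `E_j(x) = e_j(x) / D_j`, a polynomial in `x` over `F(T)`. -/
def E (j : ℕ) : (RatFunc F)[X] :=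
  C (algebraMap F[X] (RatFunc F) (D F j))⁻¹ * (e F j).map (algebraMap F[X] (RatFunc F))

/-- The `i`-th Carlitz polynomial: the extension of the `E_j` by `r`-digits, `r = #F`. -/
def carlitzPoly (i : ℕ) : (RatFunc F)[X] :=
  digitExtension (Nat.card F) (E F) i

end Polynomials

section Completion

variable {F : Type*} [Field F]

/-- The prime of `F[T]` generated by an irreducible polynomial. -/
def primeOf (π : F[X]) (hπ : Irreducible π) : HeightOneSpectrum F[X] where
  asIdeal := Ideal.span {π}
  isPrime := (Ideal.span_singleton_prime hπ.ne_zero).2 hπ.prime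
  ne_bot := by simpa using hπ.ne_zero

/-- The completion `F_π((π))` of `F(T)` at the irreducible polynomial `π`. -/
abbrev LocalField (π : F[X]) (hπ : Irreducible π) : Type _ :=
  (primeOf π hπ).adicCompletion (RatFunc F)

/-- The valuation ring `F_π[[π]]` of `F_π((π))`, i.e. the `π`-adic completion of `F[T]`. -/
abbrev LocalRing (π : F[X]) (hπ : Irreducible π) : Type _ :=
  (primeOf π hπ).adicCompletionIntegers (RatFunc F)

variable [Finite F]

theorem finite_quotient (v : HeightOneSpectrum F[X]) : Finite (F[X] ⧸ v.asIdeal) := by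
  obtain ⟨p, hp⟩ := (IsPrincipalIdealRing.principal v.asIdeal).principal
  rw [Ideal.submodule_span_eq] at hp
  have hp0 : p ≠ 0 := by
    rintro rfl
    exact v.ne_bot (by simpa using hp)
  rw [hp]
  have : Module.Finite F (F[X] ⧸ Ideal.span {p}) :=
    (AdjoinRoot.powerBasis (f := p) hp0).finite
  exact Module.finite_of_finite F

theorem one_lt_card_quotient (v : HeightOneSpectrum F[X]) :
    (1 : ℝ≥0) < Nat.card (F[X] ⧸ v.asIdeal) := by
  have := finite_quotient v
  have : Nontrivial (F[X] ⧸ v.asIdeal) := Ideal.Quotient.nontrivial_iff.2 v.isPrime.ne_top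
  exact_mod_cast Finite.one_lt_card

/-- The exponential embedding of the value group into the positive reals which sends the value
of a uniformizer to `1 / q`, where `q` is the size of the residue field. -/
instance rankOne (v : HeightOneSpectrum F[X]) :
    (Valued.v : Valuation (v.adicCompletion (RatFunc F)) ℤᵐ⁰).RankOne :=
  Valuation.IsRankOneDiscrete.rankOne _ (one_lt_card_quotient v)

/-- The normalized absolute value `|x| = q ^ (- ord x)` on the completion at `v`, where `q` is the
size of the residue field. It induces the `v`-adic topology. -/
instance normedField (v : HeightOneSpectrum F[X]) :
    NontriviallyNormedField (v.adicCompletion (RatFunc F)) :=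
  Valued.toNontriviallyNormedField _ ℤᵐ⁰

theorem exists_sub_lt_one (v : HeightOneSpectrum F[X]) (x : v.adicCompletion (RatFunc F))
    (hx : Valued.v x ≤ 1) :
    ∃ a : F[X], Valued.v (algebraMap F[X] (v.adicCompletion (RatFunc F)) a - x) < 1 := by
  have hopen : IsOpen {y : v.adicCompletion (RatFunc F) | Valued.v (y - x) < 1} := by
    have : {y : v.adicCompletion (RatFunc F) | Valued.v (y - x) < 1} = Metric.ball x 1 := by
      ext y
      simp [dist_eq_norm, Valued.toNormedField.norm_lt_one_iff]
    rw [this]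
    exact Metric.isOpen_ball
  obtain ⟨k, hk⟩ := (HeightOneSpectrum.denseRange_algebraMap (RatFunc F) v).exists_mem_open hopen
    ⟨x, by simp⟩
  have hk : Valued.v (algebraMap (RatFunc F) (v.adicCompletion (RatFunc F)) k - x) < 1 := hk
  have hval (y : RatFunc F) :
      Valued.v (algebraMap (RatFunc F) (v.adicCompletion (RatFunc F)) y) =
        v.valuation (RatFunc F) y :=
    HeightOneSpectrum.valuedAdicCompletion_eq_valuation' v y
  have hk1 : v.valuation (RatFunc F) k ≤ 1 := by
    rw [← hval, ← sub_add_cancel (algebraMap (RatFunc F) (v.adicCompletion (RatFunc F)) k) x]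
    exact (Valuation.map_add _ _ _).trans (max_le hk.le hx)
  obtain ⟨a, ha⟩ := HeightOneSpectrum.exists_valuation_sub_lt_of_integer v hk1 1
  refine ⟨a, ?_⟩
  rw [IsScalarTower.algebraMap_apply F[X] (RatFunc F) (v.adicCompletion (RatFunc F)),
    ← sub_add_sub_cancel _ (algebraMap (RatFunc F) (v.adicCompletion (RatFunc F)) k) x]
  refine (Valuation.map_add _ _ _).trans_lt (max_lt ?_ hk)
  rw [← map_sub, hval]
  exact_mod_cast ha

instance compactSpace (v : HeightOneSpectrum F[X]) :
    CompactSpace (v.adicCompletionIntegers (RatFunc F)) := by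
  have h1 : IsDiscreteValuationRing (Valued.integer (v.adicCompletion (RatFunc F))) :=
    inferInstanceAs (IsDiscreteValuationRing (v.adicCompletionIntegers (RatFunc F)))
  have h2 : Finite (IsLocalRing.ResidueField (Valued.integer (v.adicCompletion (RatFunc F)))) := by
    have := finite_quotient v
    let g : F[X] →+* Valued.integer (v.adicCompletion (RatFunc F)) :=
      algebraMap F[X] (v.adicCompletionIntegers (RatFunc F))
    have hg (a : F[X]) : (g a : v.adicCompletion (RatFunc F)) =
        algebraMap F[X] (v.adicCompletion (RatFunc F)) a := rfl
    have hmem (y : Valued.integer (v.adicCompletion (RatFunc F))) :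
        IsLocalRing.residue _ y = 0 ↔ Valued.v (y : v.adicCompletion (RatFunc F)) < 1 := by
      rw [IsLocalRing.residue_eq_zero_iff]
      exact Valuation.mem_maximalIdeal_iff _ _
    let f := Ideal.Quotient.lift v.asIdeal ((IsLocalRing.residue _).comp g) (by
      intro a ha
      rw [RingHom.comp_apply, hmem, hg]
      have := HeightOneSpectrum.valuedAdicCompletion_eq_valuation (K := RatFunc F) v a
      exact this.trans_lt ((v.valuation_lt_one_iff_mem a).2 ha))
    refine Finite.of_surjective f fun z => ?_
    obtain ⟨x, rfl⟩ := IsLocalRing.residue_surjective z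
    obtain ⟨a, ha⟩ := exists_sub_lt_one v x x.2
    refine ⟨Ideal.Quotient.mk _ a, ?_⟩
    rw [← sub_eq_zero, Ideal.Quotient.lift_mk, RingHom.comp_apply, ← map_sub, hmem]
    exact ha
  have h3 : ProperSpace (v.adicCompletion (RatFunc F)) :=
    (Valued.integer.properSpace_iff_completeSpace_and_isDiscreteValuationRing_integer_and_finite_residueField).2
      ⟨inferInstance, h1, h2⟩
  have h4 : CompactSpace (Valued.integer (v.adicCompletion (RatFunc F))) :=
    Valued.integer.properSpace_iff_compactSpace_integer.1 h3
  exact h4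

/-- The `i`-th Carlitz polynomial as a continuous function `F_π[[π]] → F_π((π))`. -/
def carlitzFun (π : F[X]) (hπ : Irreducible π) (i : ℕ) : C(LocalRing π hπ, LocalField π hπ) where
  toFun x := aeval (x : LocalField π hπ) (carlitzPoly F i)
  continuous_toFun := (carlitzPoly F i).continuous_aeval.comp continuous_subtype_val

end Completion

end Carlitz

end

/-!
Let `r = #F`, `d = deg π`, `O` the completed ring and `k` its residue field. A sequence in the unit
ball of `C(O, K)` is an orthonormal basis as soon as its reductions modulo `π` are linearly
independent over `k` and span the reductions of the functions of norm at most `1`: expansions are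
found by successive approximation modulo powers of `π`, and `‖f‖ = max ‖c i‖` follows by scaling
the largest coefficient to `1` (`isOrthonormalSchauderBasis_of_reduction`).

The functions `E_j` are `F`-linear, vanish on the polynomials of degree `< j` and take the value `1`
at `T ^ j`. They map `F[T]` to itself because of the recursion
`E_{j+1}(T x) = T E_{j+1}(x) + E_j(x) ^ r` (`ELin_succ_X_mul`), so by density they map `O` to
itself.
The reductions of the first `r ^ n` Carlitz functions are then linearly independent as functions on
the `r ^ n` polynomials of degree `< n` (`eq_zero_of_sum_digitExtension_eq_zero`), and by counting
dimensions they form a basis of the functions on this set.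

Now take `n = d m`. The polynomials of degree `< d m` represent the classes of `O / π ^ m`, and the
reduction of each of the first `r ^ (d m)` Carlitz functions factors through `O / π ^ m`. Indeed
`E_j(π ^ m x)` is divisible by `π` for `j < d m` (`norm_ELin_pow_mul_lt_one`): this follows from
`E_j(π x) = ∑ E_a(π) E_{j-a}(x) ^ (r ^ a)` (`ELin_algebraMap_mul`), since `π` divides `E_a(π)` for
`a < d`. Since every continuous function from the compact ring `O` to itself is locally
constant modulo `π`, the reductions span.
-/

noncomputable section

/-! ### Additive polynomials over an extension of `F[T]` -/

namespace Carlitz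

theorem algebraMap_C_mul_X_pow {F K : Type*} [Field F] [CommRing K] [Algebra F[X] K] [Algebra F K]
    [IsScalarTower F F[X] K] (a : F) (k : ℕ) :
    algebraMap F[X] K (C a * X ^ k) = a • algebraMap F[X] K X ^ k := by
  rw [← smul_eq_C_mul, Algebra.algebraMap_eq_smul_one, smul_assoc, ← Algebra.algebraMap_eq_smul_one,
    map_pow]

section Values

variable (F : Type*) [Field F] [Finite F]

/-- The value `∏ (x - h)`, over `h ∈ F[T]` of degree `< j`, of the polynomial `e F j` at a point `x`
of an `F[T]`-algebra. -/
def eVal {K : Type*} [CommRing K] [Algebra F[X] K] (j : ℕ) (x : K) : K :=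
  ∏ h ∈ (finite_degree_lt F j).toFinset, (x - algebraMap F[X] K h)

/-- The value `e_j(x) / D_j` of the polynomial `E F j` at a point `x` of a field over `F[T]`. -/
def EVal {K : Type*} [Field K] [Algebra F[X] K] (j : ℕ) (x : K) : K :=
  (algebraMap F[X] K (D F j))⁻¹ * eVal F j x

variable {F}

theorem D_ne_zero (j : ℕ) : D F j ≠ 0 := by
  refine Finset.prod_ne_zero_iff.2 fun h hh => ?_
  rw [Set.Finite.mem_toFinset] at hh
  exact hh.1.ne_zero

section CommRing

variable {K : Type*} [CommRing K] [Algebra F[X] K]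

theorem eVal_zero (x : K) : eVal F 0 x = x := by
  have : (finite_degree_lt F 0).toFinset = {0} := by
    ext h
    simp [Nat.WithBot.lt_zero_iff]
  rw [eVal, this]
  simp

theorem eVal_algebraMap_eq_zero {j : ℕ} {h : F[X]} (hh : h.degree < j) :
    eVal F j (algebraMap F[X] K h) = 0 :=
  Finset.prod_eq_zero ((Set.Finite.mem_toFinset _).2 hh) (sub_self _)

/-- The monic polynomials of degree `j` are the `T ^ j - h` with `deg h < j`. -/
theorem eVal_X_pow (j : ℕ) :
    eVal F j (algebraMap F[X] K (X ^ j)) = algebraMap F[X] K (D F j) := by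
  rw [eVal, D, map_prod]
  refine Finset.prod_bij' (fun h _ => X ^ j - h) (fun h _ => X ^ j - h) ?_ ?_ ?_ ?_ ?_
  · intro h hh
    simp only [Set.Finite.mem_toFinset, Set.mem_ofPred_eq] at hh ⊢
    exact ⟨monic_X_pow_sub hh, natDegree_eq_of_degree_eq_some <| by
      rw [degree_sub_eq_left_of_degree_lt] <;> simp [hh]⟩
  · intro h hh
    simp only [Set.Finite.mem_toFinset, Set.mem_ofPred_eq] at hh ⊢
    have hd : h.degree = j := by rw [degree_eq_natDegree hh.1.ne_zero, hh.2]
    have := degree_sub_lt_left (p := X ^ j) (q := h) (by simp [hd]) (by simp)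
      (by simp [hh.1.leadingCoeff])
    simpa using this
  · intros; ring
  · intros; ring
  · intros; simp

/-- The polynomials of degree `< j + 1` are the `a T ^ j + h` with `a ∈ F` and `deg h < j`. -/
theorem eVal_succ_eq_prod [Algebra F K] [IsScalarTower F F[X] K] (j : ℕ) (x : K) :
    eVal F (j + 1) x = ∏ a ∈ (Set.finite_univ (α := F)).toFinset,
      eVal F j (x - a • algebraMap F[X] K (X ^ j)) := by
  simp only [eVal]
  rw [← Finset.prod_product']
  symm
  refine Finset.prod_bij' (fun p _ => C p.1 * X ^ j + p.2)
    (fun h _ => (h.coeff j, h - C (h.coeff j) * X ^ j)) ?_ ?_ ?_ ?_ ?_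
  · rintro ⟨a, h⟩ hh
    simp only [Finset.mem_product, Set.Finite.mem_toFinset, Set.mem_ofPred_eq, Set.mem_univ,
      true_and] at hh ⊢
    refine (degree_add_le _ _).trans_lt (max_lt ?_ (hh.trans ?_))
    · exact (degree_C_mul_X_pow_le _ _).trans_lt (by exact_mod_cast j.lt_succ_self)
    · exact_mod_cast j.lt_succ_self
  · intro h hh
    simp only [Finset.mem_product, Set.Finite.mem_toFinset, Set.mem_ofPred_eq, Set.mem_univ,
      true_and] at hh ⊢
    rw [degree_lt_iff_coeff_zero] at hh ⊢
    intro m hm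
    rcases hm.eq_or_lt with rfl | hm
    · simp
    · simp [coeff_X_pow, hm.ne', hh m hm]
  · rintro ⟨a, h⟩ hh
    simp only [Finset.mem_product, Set.Finite.mem_toFinset, Set.mem_ofPred_eq, Set.mem_univ,
      true_and] at hh
    have : h.coeff j = 0 := coeff_eq_zero_of_degree_lt hh
    simp [this]
  · intro h hh
    simp
  · rintro ⟨a, h⟩ hh
    have : algebraMap F[X] K (a • X ^ j) = a • algebraMap F[X] K (X ^ j) := by
      rw [Algebra.algebraMap_eq_smul_one, smul_assoc, ← Algebra.algebraMap_eq_smul_one]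
    rw [map_add, ← smul_eq_C_mul, this, sub_sub]

end CommRing

section Field

variable {K : Type*} [Field K]

section Frobenius

variable [Algebra F K]

variable (F K) in
/-- The Frobenius map `x ↦ x ^ r` with `r = #F`, as an `F`-algebra homomorphism. -/
def frob : K →ₐ[F] K :=
  letI := Fintype.ofFinite F
  FiniteField.frobeniusAlgHom F K

theorem frob_apply (x : K) : frob F K x = x ^ Nat.card F := by
  let := Fintype.ofFinite F
  simp [frob, Nat.card_eq_fintype_card]

theorem prod_sub_algebraMap (x : K) :
    ∏ a ∈ (Set.finite_univ (α := F)).toFinset, (x - algebraMap F K a) = frob F K x - x := by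
  let := Fintype.ofFinite F
  have h : ∏ a : F, (X - C a) = (X ^ Fintype.card F - X : F[X]) := by
    have hd := FiniteField.X_pow_card_sub_X_natDegree_eq F (Fintype.one_lt_card (α := F))
    have hm : (X ^ Fintype.card F - X : F[X]).Monic :=
      monic_X_pow_sub (by rw [degree_X]; exact_mod_cast Fintype.one_lt_card)
    rw [← prod_multiset_X_sub_C_of_monic_of_roots_card_eq hm,
      FiniteField.roots_X_pow_card_sub_X]
    · rfl
    · rw [FiniteField.roots_X_pow_card_sub_X, hd]
      rfl
  have := congrArg (aeval x) h
  simp only [map_prod, map_sub, aeval_X, aeval_C, map_pow] at this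
  rw [frob_apply, Nat.card_eq_fintype_card, ← this]
  simp

end Frobenius

variable [Algebra F[X] K]

theorem EVal_zero (x : K) : EVal F 0 x = x := by
  have : D F 0 = 1 := by
    have : (finite_monic_natDegree F 0).toFinset = {1} := by
      ext h
      simp only [Set.Finite.mem_toFinset, Set.mem_ofPred_eq, Finset.mem_singleton]
      exact ⟨fun h => h.1.natDegree_eq_zero.1 h.2, by rintro rfl; simp⟩
    rw [D, this]
    simp
  simp [EVal, eVal_zero, this]

theorem EVal_algebraMap_eq_zero {j : ℕ} {h : F[X]} (hh : h.degree < j) :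
    EVal F j (algebraMap F[X] K h) = 0 := by
  rw [EVal, eVal_algebraMap_eq_zero hh, mul_zero]

variable [FaithfulSMul F[X] K]

variable (F K) in
theorem algebraMap_D_ne_zero (j : ℕ) : algebraMap F[X] K (D F j) ≠ 0 := by
  simpa using D_ne_zero j

theorem EVal_X_pow (j : ℕ) : EVal F j (algebraMap F[X] K (X ^ j)) = 1 := by
  rw [EVal, eVal_X_pow, inv_mul_cancel₀ (algebraMap_D_ne_zero F K j)]

variable [Algebra F K] [IsScalarTower F F[X] K]

variable (F K) in
/-- The functions `E_j` are `F`-linear, and `D_{j+1} E_{j+1} = D_j ^ r (E_j ^ r - E_j)`. The two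
facts are proved together, as the recursion for `E_{j+1}` rests on the linearity of `E_j` and
yields that of `E_{j+1}`. -/
theorem exists_linearMap_and_recursion (j : ℕ) : (∃ L : K →ₗ[F] K, ∀ x, L x = EVal F j x) ∧
    ∀ x : K, algebraMap F[X] K (D F (j + 1)) * EVal F (j + 1) x =
      frob F K (algebraMap F[X] K (D F j)) * (frob F K (EVal F j x) - EVal F j x) := by
  have key (j : ℕ) (L : K →ₗ[F] K) (hL : ∀ x, L x = EVal F j x) (x : K) :
      algebraMap F[X] K (D F (j + 1)) * EVal F (j + 1) x =
        frob F K (algebraMap F[X] K (D F j)) * (frob F K (EVal F j x) - EVal F j x) := by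
    have he (x : K) : eVal F j x = algebraMap F[X] K (D F j) * L x := by
      rw [hL, EVal, mul_inv_cancel_left₀ (algebraMap_D_ne_zero F K j)]
    rw [EVal, mul_inv_cancel_left₀ (algebraMap_D_ne_zero F K _), eVal_succ_eq_prod,
      ← prod_sub_algebraMap, ← hL, frob_apply]
    simp_rw [he, map_sub, map_smul, hL (algebraMap F[X] K (X ^ j)), EVal_X_pow,
      Algebra.smul_def, mul_one]
    rw [Finset.prod_mul_distrib, Finset.prod_const]
    congr 2
    rw [← Nat.card_eq_card_finite_toFinset, Nat.card_univ]
  induction j with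
  | zero =>
    have h0 : ∃ L : K →ₗ[F] K, ∀ x, L x = EVal F 0 x := ⟨LinearMap.id, fun x => (EVal_zero x).symm⟩
    exact ⟨h0, key 0 h0.choose h0.choose_spec⟩
  | succ j ih =>
    obtain ⟨⟨L, hL⟩, hrec⟩ := ih
    have h1 : ∃ L : K →ₗ[F] K, ∀ x, L x = EVal F (j + 1) x := by
      refine ⟨((algebraMap F[X] K (D F (j + 1)))⁻¹ * frob F K (algebraMap F[X] K (D F j))) •
        ((frob F K).toLinearMap ∘ₗ L - L), fun x => ?_⟩
      have := hrec x
      rw [← eq_inv_mul_iff_mul_eq₀ (algebraMap_D_ne_zero F K _)] at this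
      rw [this]
      simp [hL, mul_assoc]
    exact ⟨h1, key _ h1.choose h1.choose_spec⟩

variable (F K) in
/-- The function `E_j` as an `F`-linear map. -/
def ELin (j : ℕ) : K →ₗ[F] K where
  toFun := EVal F j
  map_add' x y := by
    obtain ⟨⟨L, hL⟩, -⟩ := exists_linearMap_and_recursion F K j
    simp only [← hL, map_add]
  map_smul' a x := by
    obtain ⟨⟨L, hL⟩, -⟩ := exists_linearMap_and_recursion F K j
    simp only [← hL, map_smul, RingHom.id_apply]

theorem ELin_apply (j : ℕ) (x : K) : ELin F K j x = EVal F j x := rfl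

theorem ELin_zero (x : K) : ELin F K 0 x = x := by
  rw [ELin_apply, EVal_zero]

theorem ELin_algebraMap_eq_zero {j : ℕ} {h : F[X]} (hh : h.degree < j) :
    ELin F K j (algebraMap F[X] K h) = 0 := by
  rw [ELin_apply, EVal_algebraMap_eq_zero hh]

theorem ELin_X_pow (j : ℕ) : ELin F K j (algebraMap F[X] K X ^ j) = 1 := by
  rw [ELin_apply, ← map_pow, EVal_X_pow]

theorem D_mul_ELin_succ (j : ℕ) (x : K) :
    algebraMap F[X] K (D F (j + 1)) * ELin F K (j + 1) x =
      frob F K (algebraMap F[X] K (D F j)) * (frob F K (ELin F K j x) - ELin F K j x) := by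
  simpa only [ELin_apply] using (exists_linearMap_and_recursion F K j).2 x

theorem D_succ (j : ℕ) : algebraMap F[X] K (D F (j + 1)) =
      frob F K (algebraMap F[X] K (D F j)) *
        (frob F K (ELin F K j (algebraMap F[X] K X ^ (j + 1))) -
          ELin F K j (algebraMap F[X] K X ^ (j + 1))) := by
  rw [← D_mul_ELin_succ (F := F), ELin_X_pow, mul_one]

/-- Division of the recursion for `E_{j+1}` by its value at `T ^ (j + 1)`. -/
theorem mul_ELin_succ (j : ℕ) (x : K) :
    (frob F K (ELin F K j (algebraMap F[X] K X ^ (j + 1))) -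
          ELin F K j (algebraMap F[X] K X ^ (j + 1))) * ELin F K (j + 1) x =
      frob F K (ELin F K j x) - ELin F K j x := by
  have h := D_mul_ELin_succ (F := F) j x
  have h0 : frob F K (algebraMap F[X] K (D F j)) ≠ 0 := by
    simpa using D_ne_zero j
  rw [D_succ, mul_assoc] at h
  exact mul_left_cancel₀ h0 h

theorem frob_sub_ne_zero (j : ℕ) : frob F K (ELin F K j (algebraMap F[X] K X ^ (j + 1))) -
          ELin F K j (algebraMap F[X] K X ^ (j + 1)) ≠ 0 := by
  have h := algebraMap_D_ne_zero F K (j + 1)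
  rw [D_succ] at h
  exact right_ne_zero_of_mul h

/-- Multiplication by `T` in the argument: `E_{j+1}(T x) = T E_{j+1}(x) + E_j(x) ^ r`. The second
part, the value of `E_j ^ r - E_j` at `T ^ (j + 1)`, is the factor `D_{j+1} / D_j ^ r` of the
recursion that the induction needs. -/
theorem ELin_succ_X_mul_aux (j : ℕ) :
    (∀ x : K, ELin F K (j + 1) (algebraMap F[X] K X * x) =
      algebraMap F[X] K X * ELin F K (j + 1) x + frob F K (ELin F K j x)) ∧
    frob F K (ELin F K j (algebraMap F[X] K X ^ (j + 1))) -
          ELin F K j (algebraMap F[X] K X ^ (j + 1)) =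
      (frob F K)^[j + 1] (algebraMap F[X] K X) - algebraMap F[X] K X := by
  set t := algebraMap F[X] K X with ht
  induction j with
  | zero =>
    have h0 : frob F K (ELin F K 0 (t ^ (0 + 1))) - ELin F K 0 (t ^ (0 + 1)) =
        (frob F K)^[0 + 1] t - t := by
      simp [ELin_zero]
    refine ⟨fun x => mul_left_cancel₀ (frob_sub_ne_zero (F := F) (K := K) 0) ?_, h0⟩
    rw [mul_add, mul_left_comm, mul_ELin_succ, mul_ELin_succ, ← ht, h0]
    simp only [ELin_zero, map_mul, Function.iterate_succ, Function.iterate_zero, Function.comp, id]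
    ring
  | succ j ih =>
    obtain ⟨h1, h2⟩ := ih
    -- By induction `E_j(T ^ (j + 1)) = T + T ^ r + ⋯ + T ^ (r ^ j)`, so that `E_j ^ r - E_j`
    -- telescopes there.
    have h3 : ELin F K (j + 1) (t ^ (j + 1 + 1)) =
        (frob F K)^[j + 1] t + ELin F K j (t ^ (j + 1)) := by
      rw [pow_succ', h1, ELin_X_pow]
      linear_combination h2
    have h4 : frob F K (ELin F K (j + 1) (t ^ (j + 1 + 1))) - ELin F K (j + 1) (t ^ (j + 1 + 1)) =
        (frob F K)^[j + 1 + 1] t - t := by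
      rw [h3, map_add, Function.iterate_succ_apply' _ (j + 1)]
      linear_combination h2
    refine ⟨fun x => mul_left_cancel₀ (frob_sub_ne_zero (F := F) (K := K) (j + 1)) ?_, h4⟩
    have h5 := congrArg (frob F K) (mul_ELin_succ (F := F) j x)
    rw [mul_add, mul_left_comm, mul_ELin_succ, mul_ELin_succ, ← ht, h4, h1]
    rw [← ht, h2] at h5
    rw [map_mul, map_sub, map_sub, ← Function.iterate_succ_apply' (frob F K)] at h5
    simp only [map_add, map_mul]
    linear_combination -h5

theorem ELin_succ_X_mul (j : ℕ) (x : K) : ELin F K (j + 1) (algebraMap F[X] K X * x) =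
      algebraMap F[X] K X * ELin F K (j + 1) x + frob F K (ELin F K j x) :=
  (ELin_succ_X_mul_aux j).1 x

/-- The functions `E_j` map `F[T]` to itself. -/
theorem exists_algebraMap_eq_ELin (j : ℕ) (g : F[X]) :
    ∃ b : F[X], algebraMap F[X] K b = ELin F K j (algebraMap F[X] K g) := by
  have hX (k : ℕ) : ∀ j, ∃ b : F[X],
      algebraMap F[X] K b = ELin F K j (algebraMap F[X] K X ^ k) := by
    induction k with
    | zero =>
      rintro (_ | j)
      · exact ⟨1, by simp [ELin_zero]⟩
      · refine ⟨0, ?_⟩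
        rw [map_zero, pow_zero, ← map_one (algebraMap F[X] K), ELin_algebraMap_eq_zero]
        rw [degree_one]
        exact_mod_cast j.succ_pos
    | succ k ih =>
      rintro (_ | j)
      · exact ⟨X ^ (k + 1), by simp [ELin_zero]⟩
      · obtain ⟨b, hb⟩ := ih (j + 1)
        obtain ⟨c, hc⟩ := ih j
        refine ⟨X * b + c ^ Nat.card F, ?_⟩
        rw [pow_succ', ELin_succ_X_mul, frob_apply, ← hb, ← hc]
        simp
  induction g using Polynomial.induction_on' with
  | add p q hp hq =>
    obtain ⟨b, hb⟩ := hp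
    obtain ⟨c, hc⟩ := hq
    exact ⟨b + c, by rw [map_add, hb, hc, map_add, map_add]⟩
  | monomial k a =>
    obtain ⟨b, hb⟩ := hX k j
    refine ⟨C a * b, ?_⟩
    have : C a * b = C a * X ^ 0 * b := by simp
    rw [← C_mul_X_pow_eq_monomial, algebraMap_C_mul_X_pow, map_smul, ← hb, this, map_mul,
      algebraMap_C_mul_X_pow, pow_zero, smul_mul_assoc, one_mul]

/-- The product formula `E_j(P x) = ∑ E_a(P) E_b(x) ^ (r ^ a)`, over `a + b = j`: the composition
law of the Carlitz module, whose action of `P` has the coefficients `E_a(P)`. -/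
theorem ELin_algebraMap_mul (P : F[X]) (j : ℕ) (x : K) :
    ELin F K j (algebraMap F[X] K P * x) = ∑ a ∈ Finset.range (j + 1),
      ELin F K a (algebraMap F[X] K P) * (frob F K)^[a] (ELin F K (j - a) x) := by
  have hX (k : ℕ) : ∀ j, ELin F K j (algebraMap F[X] K X ^ k * x) = ∑ a ∈ Finset.range (j + 1),
      ELin F K a (algebraMap F[X] K X ^ k) * (frob F K)^[a] (ELin F K (j - a) x) := by
    induction k with
    | zero =>
      intro j
      rw [Finset.sum_range_succ', Finset.sum_eq_zero]
      · simp [ELin_zero]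
      · intro a _
        rw [pow_zero, ← map_one (algebraMap F[X] K), ELin_algebraMap_eq_zero, zero_mul]
        rw [degree_one]
        exact_mod_cast a.succ_pos
    | succ k ih =>
      rintro (_ | j)
      · simp [ELin_zero]
      · rw [pow_succ', mul_assoc, ELin_succ_X_mul, ih, ih, Finset.sum_range_succ',
          Finset.sum_range_succ' _ (j + 1), map_sum, mul_add, Finset.mul_sum, add_right_comm,
          ← Finset.sum_add_distrib]
        congr 1
        · refine Finset.sum_congr rfl fun a _ => ?_
          rw [ELin_succ_X_mul, Nat.add_sub_add_right, map_mul,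
            ← Function.iterate_succ_apply' (frob F K)]
          ring
        · simp [ELin_zero, mul_assoc]
  induction P using Polynomial.induction_on' with
  | add p q hp hq =>
    simp only [map_add, add_mul, hp, hq, Finset.sum_add_distrib]
  | monomial k a =>
    rw [← C_mul_X_pow_eq_monomial, algebraMap_C_mul_X_pow, smul_mul_assoc, map_smul, hX,
      Finset.smul_sum]
    simp only [map_smul, smul_mul_assoc]

end Field

end Values

end Carlitz

/-! ### Digit expansions -/

theorem map_digitExtension {A B G : Type*} [CommMonoid A] [CommMonoid B] [FunLike G A B]
    [MonoidHomClass G A B] (φ : G) (r : ℕ) (e : ℕ → A) (i : ℕ) :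
    φ (digitExtension r e i) = digitExtension r (fun j => φ (e j)) i := by
  simp [digitExtension]

/-- For `i < r ^ n` only the first `n` terms of a sequence enter its digit extension at `i`. -/
theorem digitExtension_congr {A : Type*} [CommMonoid A] {r n i : ℕ} (hr : 1 < r) (hi : i < r ^ n)
    {e e' : ℕ → A} (h : ∀ j < n, e j = e' j) : digitExtension r e i = digitExtension r e' i := by
  have hn : (Nat.digits r i).length ≤ n := (Nat.digits_length_le_iff hr i).2 hi
  exact Finset.prod_congr rfl fun j hj => by rw [h j ((Finset.mem_range.1 hj).trans_le hn)]

theorem digitExtension_add_mul {A : Type*} [CommMonoid A] {r c : ℕ} (hr : 1 < r) (hc : c < r)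
    (e : ℕ → A) (i : ℕ) :
    digitExtension r e (c + r * i) = e 0 ^ c * digitExtension r (fun j => e (j + 1)) i := by
  by_cases h : c = 0 ∧ i = 0
  · simp [h.1, h.2, digitExtension]
  · rw [digitExtension, Nat.digits_add r hr c i hc (by tauto), List.length_cons,
      Finset.prod_range_succ', mul_comm]
    rfl

theorem sum_range_mul_eq {M : Type*} [AddCommMonoid M] (r n : ℕ) (f : ℕ → M) :
    ∑ i ∈ Finset.range (r * n), f i =
      ∑ c ∈ Finset.range r, ∑ i ∈ Finset.range n, f (c + r * i) := by
  induction n with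
  | zero => simp
  | succ n ih =>
    rw [Nat.mul_succ, Finset.sum_range_add, ih, ← Finset.sum_add_distrib]
    simp_rw [Finset.sum_range_succ _ n, add_comm (r * n)]

/-- The digit principle: for `l_j : F[T] → k` which are `F`-linear and triangular with respect to
the powers of `T`, the first `r ^ n` terms of the digit extension are linearly independent as functions
on the polynomials of degree `< n`. If `h = a + T g`, then a relation among the values at `h` is a
polynomial of degree `< r` in `l_0(h)`, whose coefficients depend only on `g`; as `a` varies,
`l_0(h)` takes `r` different values, hence the coefficients vanish, and these are relations of the
same kind for the functions `g ↦ l_{j+1}(T g)`. -/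
theorem eq_zero_of_sum_digitExtension_eq_zero {F k : Type*} [Field F] [Finite F] [Field k]
    [Algebra F k] (n : ℕ) (l : ℕ → F[X] →ₗ[F] k) (h0 : ∀ j, ∀ i < j, l j (X ^ i) = 0)
    (h1 : ∀ j, l j (X ^ j) = 1) (c : ℕ → k)
    (hc : ∀ h : F[X], h.degree < n →
      ∑ i ∈ Finset.range (Nat.card F ^ n),
        c i * digitExtension (Nat.card F) (fun j => l j h) i = 0) :
    ∀ i < Nat.card F ^ n, c i = 0 := by
  have hr : 1 < Nat.card F := Finite.one_lt_card
  let := Fintype.ofFinite F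
  set r := Nat.card F with hrdef
  induction n generalizing l c with
  | zero =>
    intro i hi
    obtain rfl : i = 0 := by simpa using hi
    simpa [digitExtension] using hc 0 (by simp)
  | succ n ih =>
    have key (b : ℕ) (hb : b < r) : ∀ i < r ^ n, c (b + r * i) = 0 := by
      refine ih (fun j => l (j + 1) ∘ₗ LinearMap.mulLeft F X)
        (fun j i hij => ?_) (fun j => ?_) (fun i => c (b + r * i)) fun g hg => ?_
      · simpa [← pow_succ'] using h0 (j + 1) (i + 1) (by omega)
      · simpa [← pow_succ'] using h1 (j + 1)
      · let P : k[X] := ∑ b ∈ Finset.range r, C (∑ i ∈ Finset.range (r ^ n), c (b + r * i) *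
          digitExtension r (fun j => l (j + 1) (X * g)) i) * X ^ b
        have hP : P = 0 := by
          refine eq_zero_of_natDegree_lt_card_of_eval_eq_zero (ι := F) P
            (f := fun a => l 0 (C a + X * g)) ?_ ?_ ?_
          · intro a a' haa
            have hC (a : F) : l 0 (C a) = algebraMap F k a := by
              rw [← mul_one (C a), ← pow_zero X, ← smul_eq_C_mul, map_smul, h1,
                Algebra.algebraMap_eq_smul_one]
            simpa [hC] using haa
          · intro a
            have hdeg : (C a + X * g).degree < ((n + 1 : ℕ) : WithBot ℕ) := by
              rw [degree_lt_iff_coeff_zero] at hg ⊢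
              rintro (_ | m) hm
              · omega
              · simpa [coeff_X_mul, coeff_C] using hg m (by omega)
            rw [← hc _ hdeg, pow_succ', sum_range_mul_eq, eval_finsetSum]
            refine Finset.sum_congr rfl fun b hb => ?_
            rw [eval_mul, eval_C, eval_pow, eval_X, Finset.sum_mul]
            refine Finset.sum_congr rfl fun i _ => ?_
            have hl (j : ℕ) : l (j + 1) (C a + X * g) = l (j + 1) (X * g) := by
              have : C a = a • (X : F[X]) ^ 0 := by rw [smul_eq_C_mul, pow_zero, mul_one]
              rw [this, map_add, map_smul, h0 _ _ j.succ_pos, smul_zero, zero_add]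
            rw [digitExtension_add_mul hr (Finset.mem_range.1 hb)]
            simp only [hl]
            ring
          · refine (natDegree_sum_le_of_forall_le (n := r - 1) _ _ fun b hb => ?_).trans_lt ?_
            · have := Finset.mem_range.1 hb
              exact (natDegree_C_mul_X_pow_le _ _).trans (by omega)
            · rw [← Nat.card_eq_fintype_card, ← hrdef]
              omega
        have := congrArg (fun p => p.coeff b) hP
        simp only [P, finsetSum_coeff, coeff_C_mul_X_pow, coeff_zero] at this
        rwa [Finset.sum_ite_eq, if_pos (Finset.mem_range.2 hb)] at this
    intro i hi
    rw [← Nat.mod_add_div i r]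
    exact key _ (Nat.mod_lt _ (by omega)) _ (Nat.div_lt_of_lt_mul (by rwa [← pow_succ']))

/-! ### Orthonormal bases and their reductions -/

section Orthonormal

variable {K E : Type*} [NontriviallyNormedField K] [NormedAddCommGroup E]
  [NormedSpace K E] [IsUltrametricDist E]

theorem norm_sum_smul_le {e : ℕ → E} (he : ∀ i, ‖e i‖ ≤ 1) {c : ℕ → K} {M : ℝ} (hM : 0 ≤ M)
    (hc : ∀ i, ‖c i‖ ≤ M) (s : Finset ℕ) : ‖∑ i ∈ s, c i • e i‖ ≤ M := by
  refine IsUltrametricDist.norm_sum_le_of_forall_le_of_nonneg hM fun i _ => ?_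
  rw [norm_smul]
  exact (mul_le_of_le_one_right (norm_nonneg _) (he i)).trans (hc i)

/-- If the reductions of the `e i` are linearly independent, then every convergent expansion with
coefficients tending to `0` satisfies `‖x‖ = max ‖c i‖`. -/
theorem isGreatest_norm_of_tendsto {e : ℕ → E} (he : ∀ i, ‖e i‖ ≤ 1)
    (hind : ∀ (c : ℕ → K) (N : ℕ), (∀ i, ‖c i‖ ≤ 1) →
      ‖∑ i ∈ Finset.range N, c i • e i‖ < 1 → ∀ i < N, ‖c i‖ < 1)
    {c : ℕ → K} {x : E} (hc : Tendsto c atTop (𝓝 0))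
    (hx : Tendsto (fun N => ∑ n ∈ Finset.range N, c n • e n) atTop (𝓝 x)) :
    IsGreatest (Set.range fun n => ‖c n‖) ‖x‖ := by
  obtain ⟨i₀, hi₀⟩ : ∃ i₀, ∀ i, ‖c i‖ ≤ ‖c i₀‖ := by
    by_cases h : ∀ i, c i = 0
    · exact ⟨0, fun i => by simp [h]⟩
    · push Not at h
      obtain ⟨i₁, hi₁⟩ := h
      have h0 : Tendsto (fun i => ‖c i‖) atTop (𝓝 0) := by simpa using hc.norm
      obtain ⟨N, hN⟩ := eventually_atTop.1 (h0.eventually_lt_const (norm_pos_iff.2 hi₁))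
      obtain ⟨i₀, -, h⟩ := Finset.exists_max_image (Finset.range (N + i₁ + 1)) (fun i => ‖c i‖)
        ⟨0, by simp⟩
      refine ⟨i₀, fun i => ?_⟩
      by_cases hi : i < N + i₁ + 1
      · exact h i (Finset.mem_range.2 hi)
      · exact (hN i (by omega)).le.trans (h i₁ (Finset.mem_range.2 (by omega)))
  have hle : ‖x‖ ≤ ‖c i₀‖ :=
    le_of_tendsto hx.norm (.of_forall fun N => norm_sum_smul_le he (norm_nonneg _) hi₀ _)
  have hge : ‖c i₀‖ ≤ ‖x‖ := by
    by_contra! hlt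
    have hpos : 0 < ‖c i₀‖ := (norm_nonneg _).trans_lt hlt
    have hne : c i₀ ≠ 0 := norm_pos_iff.1 hpos
    obtain ⟨N, hN, hN'⟩ := ((hx.norm.eventually_lt_const hlt).and
      (eventually_gt_atTop i₀)).exists
    have := hind (fun i => (c i₀)⁻¹ * c i) N (fun i => ?_) ?_ i₀ hN'
    · simp [hne] at this
    · rw [norm_mul, norm_inv, inv_mul_le_one₀ hpos]
      exact hi₀ i
    · simp_rw [mul_smul]
      rw [← Finset.smul_sum, norm_smul, norm_inv, inv_mul_lt_one₀ hpos]
      exact hN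
  rw [le_antisymm hle hge]
  exact ⟨⟨i₀, rfl⟩, by rintro _ ⟨i, rfl⟩; exact hi₀ i⟩

/-- If the reductions of the `e i` span, then every `x` has an expansion: it is approximated
successively by finite combinations modulo the powers of a uniformizer `p`. -/
theorem exists_tendsto_sum_of_approx [IsUltrametricDist K] [CompleteSpace K] {e : ℕ → E}
    (he : ∀ i, ‖e i‖ ≤ 1)
    {p : K} (hp0 : p ≠ 0) (hp1 : ‖p‖ < 1)
    (hspan : ∀ x : E, ‖x‖ ≤ 1 → ∃ (N : ℕ) (b : ℕ → K), (∀ i, ‖b i‖ ≤ 1) ∧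
      ‖x - ∑ i ∈ Finset.range N, b i • e i‖ ≤ ‖p‖) (x : E) :
    ∃ c : ℕ → K, Tendsto c atTop (𝓝 0) ∧
      Tendsto (fun N => ∑ n ∈ Finset.range N, c n • e n) atTop (𝓝 x) := by
  have hpos : 0 < ‖p‖ := norm_pos_iff.2 hp0
  -- Scaling by a power of `p` reduces to `‖x‖ ≤ 1`.
  wlog hx : ‖x‖ ≤ 1 generalizing x
  · obtain ⟨m, hm⟩ := ((tendsto_pow_atTop_nhds_zero_of_lt_one hpos.le hp1).mul_const
      ‖x‖).eventually_le_const (show 0 * ‖x‖ < 1 by simp) |>.exists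
    obtain ⟨c, hc, hcx⟩ := this (p ^ m • x) (by rwa [norm_smul, norm_pow])
    refine ⟨fun i => (p ^ m)⁻¹ * c i, by simpa using hc.const_mul (p ^ m)⁻¹, ?_⟩
    have := hcx.const_smul (p ^ m)⁻¹
    simpa [Finset.smul_sum, smul_smul, hp0] using this
  have hspan' (x : E) (hx : ‖x‖ ≤ 1) : ∃ g : ℕ →₀ K, (∀ i, ‖g i‖ ≤ 1) ∧
      ‖x - Finsupp.linearCombination K e g‖ ≤ ‖p‖ := by
    obtain ⟨N, b, hb, hN⟩ := hspan x hx
    refine ⟨∑ i ∈ Finset.range N, Finsupp.single i (b i), fun i => ?_, by simpa using hN⟩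
    rw [Finsupp.finsetSum_apply]
    simp only [Finsupp.single_apply, Finset.sum_ite_eq']
    split_ifs
    · exact hb i
    · simp
  have step (m : ℕ) (g : {g : ℕ →₀ K // ‖x - Finsupp.linearCombination K e g‖ ≤ ‖p‖ ^ m}) :
      ∃ g' : {g : ℕ →₀ K // ‖x - Finsupp.linearCombination K e g‖ ≤ ‖p‖ ^ (m + 1)},
        ∀ i, ‖g'.1 i - g.1 i‖ ≤ ‖p‖ ^ m := by
    obtain ⟨g, hg⟩ := g
    obtain ⟨f, hf1, hf⟩ := hspan' ((p ^ m)⁻¹ • (x - Finsupp.linearCombination K e g)) (by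
      rwa [norm_smul, norm_inv, norm_pow, inv_mul_le_one₀ (by positivity)])
    refine ⟨⟨g + p ^ m • f, ?_⟩, fun i => ?_⟩
    · have : x - Finsupp.linearCombination K e (g + p ^ m • f) =
          p ^ m • ((p ^ m)⁻¹ • (x - Finsupp.linearCombination K e g) -
            Finsupp.linearCombination K e f) := by
        rw [smul_sub, smul_smul, mul_inv_cancel₀ (pow_ne_zero _ hp0), one_smul, map_add, map_smul]
        abel
      rw [this, norm_smul, norm_pow, pow_succ]
      gcongr
    · simpa using mul_le_of_le_one_right (by positivity) (hf1 i)
  choose next hnext using step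
  let G (m : ℕ) : {g : ℕ →₀ K // ‖x - Finsupp.linearCombination K e g‖ ≤ ‖p‖ ^ m} :=
    Nat.rec ⟨0, by simpa using hx⟩ next m
  have hG (m i : ℕ) : ‖(G (m + 1)).1 i - (G m).1 i‖ ≤ ‖p‖ ^ m := hnext m (G m) i
  have hpow : Tendsto (fun m => ‖p‖ ^ m) atTop (𝓝 0) :=
    tendsto_pow_atTop_nhds_zero_of_lt_one hpos.le hp1
  have hmono (m i : ℕ) (k : ℕ) : ‖(G (m + k)).1 i - (G m).1 i‖ ≤ ‖p‖ ^ m := by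
    induction k with
    | zero => simp
    | succ k ih =>
      rw [← sub_add_sub_cancel _ ((G (m + k)).1 i)]
      refine (IsUltrametricDist.norm_add_le_max _ _).trans (max_le ((hG _ _).trans ?_) ih)
      exact pow_le_pow_of_le_one hpos.le hp1.le (Nat.le_add_right _ _)
  have hlim (i : ℕ) : ∃ y, Tendsto (fun m => (G m).1 i) atTop (𝓝 y) := by
    refine cauchySeq_tendsto_of_complete (cauchySeq_of_le_tendsto_0' _ (fun m n hmn => ?_) hpow)
    obtain ⟨k, rfl⟩ := Nat.exists_eq_add_of_le hmn
    rw [dist_comm, dist_eq_norm]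
    exact hmono m i k
  choose c hc using hlim
  have hcG (m i : ℕ) : ‖c i - (G m).1 i‖ ≤ ‖p‖ ^ m := by
    refine le_of_tendsto ((hc i).sub_const _).norm ?_
    filter_upwards [eventually_ge_atTop m] with n hn
    obtain ⟨k, rfl⟩ := Nat.exists_eq_add_of_le hn
    exact hmono m i k
  have hsupp (m : ℕ) : ∃ N, ∀ i, (G m).1 i ≠ 0 → i < N := by
    obtain ⟨N, hN⟩ := (G m).1.support.exists_nat_subset_range
    exact ⟨N, fun i hi => Finset.mem_range.1 (hN (Finsupp.mem_support_iff.2 hi))⟩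
  refine ⟨c, ?_, ?_⟩
  · rw [NormedAddGroup.tendsto_nhds_zero]
    intro ε hε
    obtain ⟨m, hm⟩ := (hpow.eventually_lt_const hε).exists
    obtain ⟨N, hN⟩ := hsupp m
    filter_upwards [eventually_ge_atTop N] with i hi
    have h0 : (G m).1 i = 0 := by
      by_contra h
      exact absurd (hN i h) (by omega)
    have := hcG m i
    rw [h0, sub_zero] at this
    exact this.trans_lt hm
  · rw [Metric.tendsto_atTop]
    intro ε hε
    obtain ⟨m, hm⟩ := (hpow.eventually_lt_const hε).exists
    obtain ⟨N, hN⟩ := hsupp m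
    refine ⟨N, fun L hL => ?_⟩
    have hlin : Finsupp.linearCombination K e (G m).1 =
        ∑ i ∈ Finset.range L, (G m).1 i • e i := by
      rw [Finsupp.linearCombination_apply]
      refine Finsupp.sum_of_support_subset _ (fun i hi => ?_) _ (by simp)
      exact Finset.mem_range.2 ((hN i (Finsupp.mem_support_iff.1 hi)).trans_le hL)
    have h1 : ‖∑ i ∈ Finset.range L, (c i - (G m).1 i) • e i‖ ≤ ‖p‖ ^ m :=
      norm_sum_smul_le he (by positivity) (hcG m) _
    have h2 := (G m).2
    rw [hlin, norm_sub_rev] at h2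
    rw [dist_eq_norm]
    refine lt_of_le_of_lt ?_ hm
    have : ∑ i ∈ Finset.range L, c i • e i - x =
        ∑ i ∈ Finset.range L, (c i - (G m).1 i) • e i +
          (∑ i ∈ Finset.range L, (G m).1 i • e i - x) := by
      simp only [sub_smul, Finset.sum_sub_distrib]
      abel
    rw [this]
    exact (IsUltrametricDist.norm_add_le_max _ _).trans (max_le h1 h2)

/-- A sequence in the unit ball whose reductions are linearly independent and span the reduction of
the unit ball is an orthonormal basis. -/
theorem isOrthonormalSchauderBasis_of_reduction [IsUltrametricDist K] [CompleteSpace K] {e : ℕ → E}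
    (he : ∀ i, ‖e i‖ ≤ 1) {p : K} (hp0 : p ≠ 0) (hp1 : ‖p‖ < 1)
    (hind : ∀ (c : ℕ → K) (N : ℕ), (∀ i, ‖c i‖ ≤ 1) →
      ‖∑ i ∈ Finset.range N, c i • e i‖ < 1 → ∀ i < N, ‖c i‖ < 1)
    (hspan : ∀ x : E, ‖x‖ ≤ 1 → ∃ (N : ℕ) (b : ℕ → K), (∀ i, ‖b i‖ ≤ 1) ∧
      ‖x - ∑ i ∈ Finset.range N, b i • e i‖ ≤ ‖p‖) :
    IsOrthonormalSchauderBasis K e := by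
  intro x
  obtain ⟨c, hc, hcx⟩ := exists_tendsto_sum_of_approx he hp0 hp1 hspan x
  refine ⟨c, hc, hcx, isGreatest_norm_of_tendsto he hind hc hcx, fun c' hc' hcx' => ?_⟩
  have h := isGreatest_norm_of_tendsto he hind (c := fun i => c' i - c i) (x := 0)
    (by simpa using hc'.sub hc)
    (by simpa [sub_smul] using hcx'.sub hcx)
  funext i
  have := h.2 ⟨i, rfl⟩
  rwa [norm_zero, norm_le_zero_iff, sub_eq_zero] at this

end Orthonormal

/-! ### The Carlitz functions on the completion -/

namespace Carlitz

section Completion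

variable {F : Type*} [Field F] {π : F[X]} {hπ : Irreducible π}

instance : FaithfulSMul F[X] (LocalField π hπ) := by
  rw [faithfulSMul_iff_algebraMap_injective,
    IsScalarTower.algebraMap_eq F[X] (RatFunc F) (LocalField π hπ)]
  exact (algebraMap (RatFunc F) (LocalField π hπ)).injective.comp
    (IsFractionRing.injective F[X] (RatFunc F))

theorem valued_algebraMap (g : F[X]) : Valued.v (algebraMap F[X] (LocalField π hπ) g) =
    (primeOf π hπ).intValuation g := by
  rw [← HeightOneSpectrum.valuation_of_algebraMap (K := RatFunc F)]
  exact HeightOneSpectrum.valuedAdicCompletion_eq_valuation (K := RatFunc F) (primeOf π hπ) g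

variable (π hπ) in
theorem algebraMap_prime_ne_zero : algebraMap F[X] (LocalField π hπ) π ≠ 0 := by
  simpa using hπ.ne_zero

theorem coe_algebraMap (g : F[X]) : ((algebraMap F[X] (LocalRing π hπ) g : LocalRing π hπ) :
    LocalField π hπ) = algebraMap F[X] _ g := rfl

variable [Finite F]

theorem norm_algebraMap_le_one (g : F[X]) : ‖algebraMap F[X] (LocalField π hπ) g‖ ≤ 1 := by
  rw [Valued.toNormedField.norm_le_one_iff, valued_algebraMap]
  exact HeightOneSpectrum.intValuation_le_one _ _

theorem norm_algebraMap_lt_one_iff {g : F[X]} :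
    ‖algebraMap F[X] (LocalField π hπ) g‖ < 1 ↔ π ∣ g := by
  rw [Valued.toNormedField.norm_lt_one_iff, valued_algebraMap,
    HeightOneSpectrum.intValuation_lt_one_iff_mem]
  exact Ideal.mem_span_singleton

/-- The polynomial `π` is a uniformizer: `‖π‖` is the largest norm `< 1`. -/
theorem norm_le_norm_algebraMap_prime {x : LocalField π hπ} (hx : ‖x‖ < 1) :
    ‖x‖ ≤ ‖algebraMap F[X] (LocalField π hπ) π‖ := by
  have h0 := algebraMap_prime_ne_zero π hπ
  rw [← div_le_one₀ (norm_pos_iff.2 h0), ← norm_div, Valued.toNormedField.norm_le_one_iff, map_div₀,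
    valued_algebraMap, HeightOneSpectrum.intValuation_singleton _ hπ.ne_zero rfl]
  rw [Valued.toNormedField.norm_lt_one_iff] at hx
  rw [div_le_one₀ (by simp)]
  rcases eq_or_ne (Valued.v x) 0 with h | h
  · simp [h]
  · rw [← WithZero.exp_log h] at hx ⊢
    rw [← WithZero.exp_zero, WithZero.exp_lt_exp] at hx
    rw [WithZero.exp_le_exp]
    omega

theorem exists_eq_add_mul {x : LocalField π hπ} (hx : ‖x‖ ≤ 1) :
    ∃ (a : F[X]) (y : LocalField π hπ), a.degree < π.degree ∧ ‖y‖ ≤ 1 ∧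
      x = algebraMap F[X] _ a + algebraMap F[X] _ π * y := by
  have h0 := algebraMap_prime_ne_zero π hπ
  obtain ⟨b, hb⟩ := exists_sub_lt_one (primeOf π hπ) x (Valued.toNormedField.norm_le_one_iff.1 hx)
  rw [← Valued.toNormedField.norm_lt_one_iff] at hb
  refine ⟨b % π, (x - algebraMap F[X] _ (b % π)) / algebraMap F[X] _ π,
    EuclideanDomain.mod_lt b hπ.ne_zero, ?_, by field_simp; ring⟩
  rw [norm_div, div_le_one₀ (norm_pos_iff.2 h0)]
  refine norm_le_norm_algebraMap_prime ?_
  have : x - algebraMap F[X] (LocalField π hπ) (b % π) =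
      -(algebraMap F[X] _ b - x) + algebraMap F[X] _ (π * (b / π)) := by
    nth_rw 2 [← EuclideanDomain.div_add_mod b π]
    rw [map_add]
    ring
  rw [this]
  refine (IsUltrametricDist.norm_add_le_max _ _).trans_lt (max_lt (by rwa [norm_neg]) ?_)
  exact norm_algebraMap_lt_one_iff.2 (dvd_mul_right _ _)

/-- The polynomials of degree `< m deg π` represent the residue classes modulo `π ^ m`. -/
theorem exists_eq_add_pow_mul (m : ℕ) {x : LocalField π hπ} (hx : ‖x‖ ≤ 1) :
    ∃ (h : F[X]) (y : LocalField π hπ), h.degree < (π.natDegree * m : ℕ) ∧ ‖y‖ ≤ 1 ∧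
      x = algebraMap F[X] _ h + algebraMap F[X] _ π ^ m * y := by
  induction m with
  | zero => exact ⟨0, x, by simp, hx, by simp⟩
  | succ m ih =>
    obtain ⟨h, y, hh, hy, rfl⟩ := ih
    obtain ⟨a, z, ha, hz, rfl⟩ := exists_eq_add_mul hy
    refine ⟨h + π ^ m * a, z, ?_, hz, by rw [map_add, map_mul, map_pow]; ring⟩
    refine (degree_add_le _ _).trans_lt (max_lt (hh.trans_le ?_) ?_)
    · exact_mod_cast Nat.mul_le_mul_left _ m.le_succ
    · rcases eq_or_ne a 0 with rfl | ha0
      · rw [mul_zero, degree_zero]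
        exact WithBot.bot_lt_coe _
      · have := natDegree_lt_natDegree ha0 ha
        rw [degree_eq_natDegree (mul_ne_zero (pow_ne_zero _ hπ.ne_zero) ha0),
          natDegree_mul (pow_ne_zero _ hπ.ne_zero) ha0, natDegree_pow]
        norm_cast
        rw [mul_add, mul_comm m, mul_one]
        omega

theorem continuous_ELin (j : ℕ) : Continuous (ELin F (LocalField π hπ) j) := by
  change Continuous (EVal F j)
  unfold EVal eVal
  fun_prop

/-- `E_j` maps `F[T]` to itself, and `F[T]` is dense in the unit ball. -/
theorem norm_ELin_le_one (j : ℕ) {x : LocalField π hπ} (hx : ‖x‖ ≤ 1) :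
    ‖ELin F (LocalField π hπ) j x‖ ≤ 1 := by
  have hp : ‖algebraMap F[X] (LocalField π hπ) π‖ < 1 := norm_algebraMap_lt_one_iff.2 dvd_rfl
  choose h y _ hy hxy using fun m => exists_eq_add_pow_mul m hx
  have hlim : Tendsto (fun m => algebraMap F[X] (LocalField π hπ) (h m)) atTop (𝓝 x) := by
    rw [tendsto_iff_norm_sub_tendsto_zero]
    refine squeeze_zero (fun _ => norm_nonneg _) (fun m => ?_)
      (tendsto_pow_atTop_nhds_zero_of_lt_one (norm_nonneg _) hp)
    have : algebraMap F[X] _ (h m) - x = -(algebraMap F[X] _ π ^ m * y m) := by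
      linear_combination -hxy m
    rw [this, norm_neg, norm_mul, norm_pow]
    exact mul_le_of_le_one_right (by positivity) (hy m)
  refine le_of_tendsto (((continuous_ELin j).tendsto x).comp hlim).norm (.of_forall fun m => ?_)
  obtain ⟨b, hb⟩ := exists_algebraMap_eq_ELin (K := LocalField π hπ) j (h m)
  rw [Function.comp_apply, ← hb]
  exact norm_algebraMap_le_one b

/-- For `j < deg π` the factor `h = 0` of `e_j(π)` is divisible by `π`, while `D_j`, a product of
nonzero polynomials of degree `< deg π`, is not. -/
theorem norm_ELin_prime_lt_one {j : ℕ} (hj : j < π.natDegree) :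
    ‖ELin F (LocalField π hπ) j (algebraMap F[X] _ π)‖ < 1 := by
  obtain ⟨b, hb⟩ := exists_algebraMap_eq_ELin (K := LocalField π hπ) j π
  rw [← hb, norm_algebraMap_lt_one_iff]
  have hD : D F j * b = ∏ h ∈ (finite_degree_lt F j).toFinset, (π - h) := by
    apply FaithfulSMul.algebraMap_injective F[X] (LocalField π hπ)
    rw [map_mul, hb, ELin_apply, EVal, mul_inv_cancel_left₀ (algebraMap_D_ne_zero F _ j), eVal,
      map_prod]
    simp only [map_sub]
  refine (hπ.prime.dvd_or_dvd (hD ▸ ?_ : π ∣ D F j * b)).resolve_left fun hdvd => ?_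
  · have h0 : (0 : F[X]) ∈ (finite_degree_lt F j).toFinset := by
      simp
    exact (by simp : π ∣ π - 0).trans (Finset.dvd_prod_of_mem (fun h => π - h) h0)
  · obtain ⟨h, hh, hdvd⟩ := (Prime.dvd_finsetProd_iff hπ.prime _).1 hdvd
    rw [Set.Finite.mem_toFinset] at hh
    have := natDegree_le_of_dvd hdvd hh.1.ne_zero
    rw [hh.2] at this
    omega

theorem iterate_frob_apply (a : ℕ) (x : LocalField π hπ) :
    (frob F (LocalField π hπ))^[a] x = x ^ Nat.card F ^ a := by
  induction a with
  | zero => simp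
  | succ a ih => rw [Function.iterate_succ_apply', ih, frob_apply, ← pow_mul, pow_succ]

/-- Modulo `π` the function `E_j` with `j < m deg π` depends only on the class of its argument
modulo `π ^ m`. Each term of the product formula for `E_j(π x)` contains a value `E_a(π)` with
`a < deg π` or a value of some `E_b` with `b < (m - 1) deg π`. -/
theorem norm_ELin_pow_mul_lt_one (m : ℕ) {j : ℕ} (hj : j < π.natDegree * m) {x : LocalField π hπ}
    (hx : ‖x‖ ≤ 1) : ‖ELin F (LocalField π hπ) j (algebraMap F[X] _ π ^ m * x)‖ < 1 := by
  induction m generalizing j with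
  | zero => simp at hj
  | succ m ih =>
    rw [pow_succ', mul_assoc, ELin_algebraMap_mul]
    have hy : ‖algebraMap F[X] (LocalField π hπ) π ^ m * x‖ ≤ 1 := by
      rw [norm_mul, norm_pow]
      exact mul_le_one₀ (pow_le_one₀ (norm_nonneg _) (norm_algebraMap_le_one π))
        (norm_nonneg _) hx
    obtain ⟨a, ha, hle⟩ := IsUltrametricDist.exists_norm_finsetSum_le (Finset.range (j + 1))
      fun a => ELin F (LocalField π hπ) a (algebraMap F[X] _ π) *
        (frob F (LocalField π hπ))^[a] (ELin F (LocalField π hπ) (j - a)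
          (algebraMap F[X] _ π ^ m * x))
    refine hle.trans_lt ?_
    rw [iterate_frob_apply, norm_mul, norm_pow]
    by_cases had : a < π.natDegree
    · exact mul_lt_one_of_nonneg_of_lt_one_left (norm_nonneg _) (norm_ELin_prime_lt_one had)
        (pow_le_one₀ (norm_nonneg _) (norm_ELin_le_one _ hy))
    · refine mul_lt_one_of_nonneg_of_lt_one_right (norm_ELin_le_one _ (norm_algebraMap_le_one π))
        (by positivity) (pow_lt_one₀ (norm_nonneg _) (ih ?_) ?_)
      · rw [Nat.mul_succ] at hj
        have := Finset.mem_range.1 (ha ⟨0, by simp⟩)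
        omega
      · exact pow_ne_zero _ Nat.card_pos.ne'

theorem norm_coe_le_one (x : LocalRing π hπ) : ‖(x : LocalField π hπ)‖ ≤ 1 :=
  Valued.toNormedField.norm_le_one_iff.2 x.2

theorem residue_eq_zero_iff_norm_lt_one {x : LocalRing π hπ} :
    IsLocalRing.residue _ x = 0 ↔ ‖(x : LocalField π hπ)‖ < 1 := by
  rw [IsLocalRing.residue_eq_zero_iff, Valued.toNormedField.norm_lt_one_iff]
  exact Valuation.mem_maximalIdeal_iff _ _

variable (π hπ) in
/-- The function `E_j` as a self-map of the valuation ring. -/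
def EInt (j : ℕ) (x : LocalRing π hπ) : LocalRing π hπ :=
  ⟨ELin F (LocalField π hπ) j x,
    Valued.toNormedField.norm_le_one_iff.1 (norm_ELin_le_one j (norm_coe_le_one x))⟩

theorem carlitzFun_apply (i : ℕ) (x : LocalRing π hπ) : carlitzFun π hπ i x =
    (digitExtension (Nat.card F) (fun j => EInt π hπ j x) i : LocalRing π hπ) := by
  have hE (j : ℕ) : aeval (x : LocalField π hπ) (E F j) = EVal F j (x : LocalField π hπ) := by
    rw [E, map_mul, aeval_C, EVal, map_inv₀, ← IsScalarTower.algebraMap_apply, aeval_map_algebraMap,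
      e, eVal, map_prod]
    simp
  change aeval (x : LocalField π hπ) (digitExtension (Nat.card F) (E F) i) =
    ((primeOf π hπ).adicCompletionIntegers (RatFunc F)).subtype _
  have h1 := map_digitExtension (aeval (R := RatFunc F) (x : LocalField π hπ))
    (Nat.card F) (E F) i
  have h2 := map_digitExtension
    ((primeOf π hπ).adicCompletionIntegers (RatFunc F)).subtype
    (Nat.card F) (fun j => EInt π hπ j x) i
  refine h1.trans (Eq.trans ?_ h2.symm)
  congr 1
  funext j
  exact hE j

theorem residue_EInt_congr {m j : ℕ} (hj : j < π.natDegree * m) {x y : LocalRing π hπ}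
    {z : LocalField π hπ} (hz : ‖z‖ ≤ 1)
    (h : (x : LocalField π hπ) = y + algebraMap F[X] _ π ^ m * z) :
    IsLocalRing.residue _ (EInt π hπ j x) = IsLocalRing.residue _ (EInt π hπ j y) := by
  rw [← sub_eq_zero, ← map_sub, residue_eq_zero_iff_norm_lt_one]
  have : ((EInt π hπ j x - EInt π hπ j y : LocalRing π hπ) : LocalField π hπ) =
      ELin F (LocalField π hπ) j (algebraMap F[X] _ π ^ m * z) := by
    change ELin F _ j (x : LocalField π hπ) - ELin F _ j (y : LocalField π hπ) = _
    rw [h, map_add, add_sub_cancel_left]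
  rw [this]
  exact norm_ELin_pow_mul_lt_one m hj hz

/-- The reductions of the Carlitz functions with index `< r ^ n` are linearly independent as
functions on the polynomials of degree `< n`. -/
theorem eq_zero_of_sum_residue_eq_zero (n : ℕ)
    (c : ℕ → IsLocalRing.ResidueField (LocalRing π hπ))
    (hc : ∀ h : F[X], h.degree < n → ∑ i ∈ Finset.range (Nat.card F ^ n), c i *
      IsLocalRing.residue _ (digitExtension (Nat.card F)
        (fun j => EInt π hπ j (algebraMap F[X] _ h)) i) = 0) :
    ∀ i < Nat.card F ^ n, c i = 0 := by
  let φ : F[X] →+* IsLocalRing.ResidueField (LocalRing π hπ) :=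
    (IsLocalRing.residue _).comp (algebraMap F[X] (LocalRing π hπ))
  let : Algebra F (IsLocalRing.ResidueField (LocalRing π hπ)) := (φ.comp C).toAlgebra
  let l (j : ℕ) : F[X] →ₗ[F] IsLocalRing.ResidueField (LocalRing π hπ) :=
    { toFun h := IsLocalRing.residue _ (EInt π hπ j (algebraMap F[X] _ h))
      map_add' g h := by
        rw [← map_add]
        congr 1
        ext
        simp [EInt]
      map_smul' a h := by
        change _ = IsLocalRing.residue _ (algebraMap F[X] _ (C a)) * _
        rw [← map_mul]
        congr 1
        ext
        simp only [EInt, coe_algebraMap, MulMemClass.coe_mul]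
        have h1 : algebraMap F[X] (LocalField π hπ) (C a) = a • 1 := by
          simpa using algebraMap_C_mul_X_pow (K := LocalField π hπ) a 0
        rw [smul_eq_C_mul, map_mul, h1, smul_mul_assoc, one_mul, map_smul, smul_mul_assoc,
          one_mul] }
  refine eq_zero_of_sum_digitExtension_eq_zero n l (fun j i hij => ?_) (fun j => ?_) c ?_
  · change IsLocalRing.residue _ (EInt π hπ j (algebraMap F[X] _ (X ^ i))) = 0
    rw [residue_eq_zero_iff_norm_lt_one]
    change ‖ELin F (LocalField π hπ) j (algebraMap F[X] _ (X ^ i))‖ < 1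
    rw [ELin_algebraMap_eq_zero, norm_zero]
    · exact one_pos
    · rw [degree_X_pow]
      exact_mod_cast hij
  · change IsLocalRing.residue _ (EInt π hπ j (algebraMap F[X] _ (X ^ j))) = 1
    rw [← map_one (IsLocalRing.residue _)]
    congr 1
    refine Subtype.ext ?_
    exact EVal_X_pow (F := F) (K := LocalField π hπ) j
  · intro h hh
    rw [← hc h hh]
    refine Finset.sum_congr rfl fun i _ => ?_
    congr 1
    exact (map_digitExtension (IsLocalRing.residue (LocalRing π hπ)) _ _ _).symm

theorem residue_digitExtension_congr {m i : ℕ} (hi : i < Nat.card F ^ (π.natDegree * m))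
    {x y : LocalRing π hπ} {z : LocalField π hπ} (hz : ‖z‖ ≤ 1)
    (h : (x : LocalField π hπ) = y + algebraMap F[X] _ π ^ m * z) :
    IsLocalRing.residue _ (digitExtension (Nat.card F) (fun j => EInt π hπ j x) i) =
      IsLocalRing.residue _ (digitExtension (Nat.card F) (fun j => EInt π hπ j y) i) := by
  have := map_digitExtension (IsLocalRing.residue (LocalRing π hπ)) (Nat.card F)
  refine (this _ i).trans (Eq.trans ?_ (this _ i).symm)
  exact digitExtension_congr Finite.one_lt_card hi fun j hj => residue_EInt_congr hj hz h

/-- Every function on the polynomials of degree `< n` is a combination of the reductions of the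
first `r ^ n` Carlitz functions, since there are `r ^ n` such polynomials. -/
theorem exists_sum_residue_eq (n : ℕ) (f : F[X] → IsLocalRing.ResidueField (LocalRing π hπ)) :
    ∃ c : ℕ → IsLocalRing.ResidueField (LocalRing π hπ), ∀ h : F[X], h.degree < n →
      ∑ i ∈ Finset.range (Nat.card F ^ n), c i * IsLocalRing.residue _
        (digitExtension (Nat.card F) (fun j => EInt π hπ j (algebraMap F[X] _ h)) i) = f h := by
  have : Finite (degreeLT F n) := Finite.of_equiv _ (degreeLTEquiv F n).symm.toEquiv
  let := Fintype.ofFinite (degreeLT F n)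
  let A : Matrix (degreeLT F n) (Fin (Nat.card F ^ n))
      (IsLocalRing.ResidueField (LocalRing π hπ)) := fun h i =>
    IsLocalRing.residue _
      (digitExtension (Nat.card F) (fun j => EInt π hπ j (algebraMap F[X] _ h.1)) i)
  have hA (c : ℕ → IsLocalRing.ResidueField (LocalRing π hπ)) (h : degreeLT F n) :
      A.mulVecLin (fun i => c i) h =
      ∑ i ∈ Finset.range (Nat.card F ^ n), c i * IsLocalRing.residue _
        (digitExtension (Nat.card F) (fun j => EInt π hπ j (algebraMap F[X] _ h.1)) i) := by
    rw [Finset.sum_range]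
    change ∑ i, A h i * c i = _
    exact Finset.sum_congr rfl fun i _ => mul_comm (A h i) (c i)
  have hext (c : Fin (Nat.card F ^ n) → IsLocalRing.ResidueField (LocalRing π hπ)) :
      ∃ c' : ℕ → IsLocalRing.ResidueField (LocalRing π hπ), (fun i : Fin _ => c' i) = c :=
    ⟨fun i => if hi : i < Nat.card F ^ n then c ⟨i, hi⟩ else 0, by ext i; simp⟩
  have hinj : Function.Injective A.mulVecLin := by
    refine (injective_iff_map_eq_zero _).2 fun c hc => ?_
    obtain ⟨c, rfl⟩ := hext c
    funext i
    refine eq_zero_of_sum_residue_eq_zero n c (fun h hh => ?_) i i.2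
    rw [← hA c ⟨h, mem_degreeLT.2 hh⟩, hc]
    rfl
  have hcard : Module.finrank (IsLocalRing.ResidueField (LocalRing π hπ))
        (Fin (Nat.card F ^ n) → IsLocalRing.ResidueField (LocalRing π hπ)) =
      Module.finrank (IsLocalRing.ResidueField (LocalRing π hπ))
        (degreeLT F n → IsLocalRing.ResidueField (LocalRing π hπ)) := by
    rw [Module.finrank_fintype_fun_eq_card, Module.finrank_fintype_fun_eq_card, Fintype.card_fin,
      ← Nat.card_eq_fintype_card, Nat.card_congr (degreeLTEquiv F n).toEquiv, Nat.card_fun,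
      Nat.card_fin]
  obtain ⟨c, hc⟩ := (LinearMap.injective_iff_surjective_of_finrank_eq_finrank hcard).1 hinj
    fun h => f h.1
  obtain ⟨c, rfl⟩ := hext c
  refine ⟨c, fun h hh => ?_⟩
  exact (hA c ⟨h, mem_degreeLT.2 hh⟩).symm.trans (congrFun hc _)

theorem norm_carlitzFun_le_one (i : ℕ) : ‖carlitzFun π hπ i‖ ≤ 1 := by
  refine (ContinuousMap.norm_le _ zero_le_one).2 fun x => ?_
  rw [carlitzFun_apply]
  exact norm_coe_le_one _

theorem sum_smul_carlitzFun_apply (c : ℕ → LocalRing π hπ) (s : Finset ℕ) (x : LocalRing π hπ) :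
    (∑ i ∈ s, (c i : LocalField π hπ) • carlitzFun π hπ i) x =
      (∑ i ∈ s, c i * digitExtension (Nat.card F) (fun j => EInt π hπ j x) i : LocalRing π hπ) := by
  rw [ContinuousMap.sum_apply]
  simp [carlitzFun_apply]

theorem norm_lt_one_of_norm_sum_lt_one (c : ℕ → LocalField π hπ) (N : ℕ) (hc : ∀ i, ‖c i‖ ≤ 1)
    (hsum : ‖∑ i ∈ Finset.range N, c i • carlitzFun π hπ i‖ < 1) : ∀ i < N, ‖c i‖ < 1 := by
  intro i hi
  let b (i : ℕ) : LocalRing π hπ :=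
    if i < N then ⟨c i, Valued.toNormedField.norm_le_one_iff.1 (hc i)⟩ else 0
  -- Extension of `c` by zero to the first `r ^ N` indices, where the reductions are independent.
  have hN : N ≤ Nat.card F ^ N := (Nat.lt_pow_self Finite.one_lt_card).le
  have hb : ∀ i < Nat.card F ^ N, IsLocalRing.residue _ (b i) = 0 := by
    refine eq_zero_of_sum_residue_eq_zero N (fun i => IsLocalRing.residue _ (b i)) fun h _ => ?_
    simp only [← map_mul]
    rw [← map_sum, residue_eq_zero_iff_norm_lt_one, ← sum_smul_carlitzFun_apply]
    refine lt_of_le_of_lt ?_ hsum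
    refine le_trans (le_of_eq ?_) (ContinuousMap.norm_coe_le_norm _ (algebraMap F[X] _ h))
    congr 2
    symm
    refine Finset.sum_subset_zero_on_sdiff (Finset.range_subset_range.2 hN) (fun i hi => ?_)
      fun i hi => ?_
    · have : ¬ i < N := by simpa using (Finset.mem_sdiff.1 hi).2
      simp [b, this]
    · simp [b, Finset.mem_range.1 hi]
  have := residue_eq_zero_iff_norm_lt_one.1 (hb i (hi.trans_le hN))
  simpa [b, hi] using this

/-- A continuous function on the compact ring `O` is, modulo `π`, a function on `O / π ^ m` for some
`m`, and these are combinations of the reductions of the Carlitz functions. -/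
theorem exists_norm_sub_sum_le (f : C(LocalRing π hπ, LocalField π hπ))
    (hf : ‖f‖ ≤ 1) : ∃ (N : ℕ) (b : ℕ → LocalField π hπ), (∀ i, ‖b i‖ ≤ 1) ∧
      ‖f - ∑ i ∈ Finset.range N, b i • carlitzFun π hπ i‖ ≤
        ‖algebraMap F[X] (LocalField π hπ) π‖ := by
  have hp : ‖algebraMap F[X] (LocalField π hπ) π‖ < 1 := norm_algebraMap_lt_one_iff.2 dvd_rfl
  obtain ⟨m, hm⟩ : ∃ m, ∀ x y : LocalRing π hπ,
      ‖(x - y : LocalField π hπ)‖ ≤ ‖algebraMap F[X] (LocalField π hπ) π‖ ^ m →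
      ‖f x - f y‖ < 1 := by
    obtain ⟨δ, hδ, h⟩ := Metric.uniformContinuous_iff.1
      (CompactSpace.uniformContinuous_of_continuous f.continuous) 1 one_pos
    obtain ⟨m, hm⟩ := ((tendsto_pow_atTop_nhds_zero_of_lt_one (norm_nonneg _)
      hp).eventually_lt_const hδ).exists
    refine ⟨m, fun x y hxy => ?_⟩
    rw [← dist_eq_norm]
    refine h ?_
    rw [Subtype.dist_eq, dist_eq_norm]
    exact hxy.trans_lt hm
  obtain ⟨g, hg⟩ : ∃ g : LocalRing π hπ → LocalRing π hπ, ∀ x, (g x : LocalField π hπ) = f x :=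
    ⟨fun x => ⟨f x, Valued.toNormedField.norm_le_one_iff.1 ((f.norm_coe_le_norm x).trans hf)⟩,
      fun _ => rfl⟩
  obtain ⟨c, hc⟩ := exists_sum_residue_eq (π := π) (hπ := hπ) (π.natDegree * m)
    fun h => IsLocalRing.residue _ (g (algebraMap F[X] _ h))
  choose b hb using fun i => IsLocalRing.residue_surjective (c i)
  refine ⟨Nat.card F ^ (π.natDegree * m), fun i => b i, fun i => norm_coe_le_one _,
    (ContinuousMap.norm_le _ (norm_nonneg _)).2 fun x => norm_le_norm_algebraMap_prime ?_⟩
  rw [ContinuousMap.sub_apply, sum_smul_carlitzFun_apply, ← hg, ← AddSubgroupClass.coe_sub,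
    ← residue_eq_zero_iff_norm_lt_one]
  obtain ⟨h, y, hh, hy, hxy⟩ := exists_eq_add_pow_mul m (norm_coe_le_one x)
  have hxh : IsLocalRing.residue _ (g x) = IsLocalRing.residue _ (g (algebraMap F[X] _ h)) := by
    rw [← sub_eq_zero, ← map_sub, residue_eq_zero_iff_norm_lt_one, AddSubgroupClass.coe_sub, hg, hg]
    refine hm _ _ ?_
    rw [coe_algebraMap, hxy, add_sub_cancel_left, norm_mul, norm_pow]
    exact mul_le_of_le_one_right (by positivity) hy
  rw [map_sub, hxh, ← hc h hh, map_sum, sub_eq_zero]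
  refine Finset.sum_congr rfl fun i hi => ?_
  rw [map_mul, hb, residue_digitExtension_congr (x := x) (y := algebraMap F[X] _ h)
    (Finset.mem_range.1 hi) hy hxy]

end Completion

end Carlitz

end

theorem theorem5p5 {F : Type*} [Field F] [Finite F] (π : F[X]) (hπ : Irreducible π) :
    IsOrthonormalSchauderBasis (Carlitz.LocalField π hπ) (Carlitz.carlitzFun π hπ) :=
  isOrthonormalSchauderBasis_of_reduction Carlitz.norm_carlitzFun_le_one
    (Carlitz.algebraMap_prime_ne_zero π hπ) (Carlitz.norm_algebraMap_lt_one_iff.2 dvd_rfl)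
    Carlitz.norm_lt_one_of_norm_sum_lt_one Carlitz.exists_norm_sub_sum_le
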